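/- Let $k$ be a field with $\operatorname{char} k = 0$. An algebra over $k$ is not assumed to be unital or associative; it is alternative if $(xx)y = x(xy)$ and $y(xx) = (yx)x$ hold identically. Let $\Theta$ be the variety of all alternative algebras over $k$, and for a set $X$ let $F(X)$ be the free algebra of $\Theta$ on $X$. Fix a countably infinite set $X_0$, and let $\Theta^0$ be the category whose objects are the algebras $F(X)$ for all finite $X \subset X_0$ and whose morphisms are all algebra homomorphisms. Let $\mathfrak A$ be the group of all automorphisms of the category $\Theta^0$, and $\mathfrak Y \trianglelefteq \mathfrak A$ the subgroup of inner automorphisms, i.e. those that are isomorphic as functors to the identity. Then $$\mathfrak A/\mathfrak Y \;\cong\; \mathbf S_2 \times \operatorname{Aut} k,$$ where $\mathbf S_2$ is the symmetric group on two letters and $\operatorname{Aut} k$ is the group of field automorphisms of $k$. Moreover, consider systems of words $W = \{w_0,\, w_\lambda\ (\lambda\in k),\, w_+,\, w_\cdot\}$ with $w_0 \in F(\varnothing)$, $w_\lambda \in F(x_1)$ and $w_+, w_\cdot \in F(x_1,x_2)$. For $F = F(X)$ in $\Theta^0$ let $F^*_W$ be the set $F$ with the operations $0$, multiplication by $\lambda$,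 $+$ and $\cdot$ replaced by the operations $(h_1,\dots,h_m)\mapsto w(h_1,\dots,h_m)$ given by the respective words of $W$. Call $W$ admissible if for every $F = F(X)$ in $\Theta^0$ there is an isomorphism $\sigma_F : F \to F^*_W$ with $\sigma_F|_X = \mathrm{id}_X$. Then $W$ is admissible if and only if $w_0 = 0$, $w_+ = x_1 + x_2$, there is $\varphi \in \operatorname{Aut} k$ with $w_\lambda = \varphi(\lambda)x_1$ for all $\lambda \in k$, and either $w_\cdot = \alpha_{1,2}\,x_1x_2$ with $0 \neq \alpha_{1,2} \in k$ or $w_\cdot = \alpha_{2,1}\,x_2x_1$ with $0 \neq \alpha_{2,1}\in k$. In particular, the multiplication words of admissible systems are exactly the words $\alpha_{1,2}\,x_1x_2$ and $\alpha_{2,1}\,x_2x_1$ with nonzero coefficient. -/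

import Mathlib

open CategoryTheory

universe u v w

/-- Alternativity, for a (non-unital, non-associative) algebra: the two identities
`(x x) y = x (x y)` and `y (x x) = (y x) x`. -/
class IsAlternative (A : Type*) [Mul A] : Prop where
  left_alt : ∀ x y : A, (x * x) * y = x * (x * y)
  right_alt : ∀ x y : A, y * (x * x) = (y * x) * x

/-- The relation on the absolutely free (non-unital, non-associative) `k`-algebra on `X` whose
quotient is the free alternative algebra on `X`. The equivalence relation that it generates is the
least congruence containing the instances of the two alternative identities. -/
inductive FreeAlt.Rel (k : Type u) (X : Type v) [Field k] :
    FreeNonUnitalNonAssocAlgebra k X → FreeNonUnitalNonAssocAlgebra k X → Prop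
  | left_alt (a b : FreeNonUnitalNonAssocAlgebra k X) :
      FreeAlt.Rel k X ((a * a) * b) (a * (a * b))
  | right_alt (a b : FreeNonUnitalNonAssocAlgebra k X) :
      FreeAlt.Rel k X (b * (a * a)) ((b * a) * a)
  | smul (t : k) {a b : FreeNonUnitalNonAssocAlgebra k X} :
      FreeAlt.Rel k X a b → FreeAlt.Rel k X (t • a) (t • b)
  | add_right {a b : FreeNonUnitalNonAssocAlgebra k X} (c : FreeNonUnitalNonAssocAlgebra k X) :
      FreeAlt.Rel k X a b → FreeAlt.Rel k X (a + c) (b + c)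
  | mul_left (a : FreeNonUnitalNonAssocAlgebra k X) {b c : FreeNonUnitalNonAssocAlgebra k X} :
      FreeAlt.Rel k X b c → FreeAlt.Rel k X (a * b) (a * c)
  | mul_right {a b : FreeNonUnitalNonAssocAlgebra k X} (c : FreeNonUnitalNonAssocAlgebra k X) :
      FreeAlt.Rel k X a b → FreeAlt.Rel k X (a * c) (b * c)

/-- The free (non-unital) alternative `k`-algebra `F(X)` on a set `X`. Its universal property is
`FreeAlt.lift`. -/
def FreeAlt (k : Type u) (X : Type v) [Field k] : Type (max u v) :=
  Quot (FreeAlt.Rel k X)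

noncomputable section

namespace FreeAlt

section Structure

variable {k : Type u} {X : Type v} [Field k]

theorem Rel.add_left (a : FreeNonUnitalNonAssocAlgebra k X) {b c : FreeNonUnitalNonAssocAlgebra k X}
    (h : Rel k X b c) : Rel k X (a + b) (a + c) := by
  rw [add_comm _ b, add_comm _ c]; exact h.add_right _

theorem Rel.neg {a b : FreeNonUnitalNonAssocAlgebra k X} (h : Rel k X a b) :
    Rel k X (-a) (-b) := by
  simpa only [neg_one_smul] using h.smul (-1)

theorem Rel.sub_left (a : FreeNonUnitalNonAssocAlgebra k X) {b c : FreeNonUnitalNonAssocAlgebra k X}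
    (h : Rel k X b c) : Rel k X (a - b) (a - c) := by
  simpa only [sub_eq_add_neg] using h.neg.add_left a

theorem Rel.sub_right {a b : FreeNonUnitalNonAssocAlgebra k X}
    (c : FreeNonUnitalNonAssocAlgebra k X) (h : Rel k X a b) : Rel k X (a - c) (b - c) := by
  simpa only [sub_eq_add_neg] using h.add_right (-c)

instance : Zero (FreeAlt k X) where
  zero := Quot.mk _ 0

instance : Add (FreeAlt k X) where
  add := Quot.map₂ (· + ·) (fun a _ _ h => Rel.add_left a h) (fun _ _ c h => Rel.add_right c h)

instance : Neg (FreeAlt k X) where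
  neg := Quot.map (fun a => -a) (fun _ _ h => Rel.neg h)

instance : Sub (FreeAlt k X) where
  sub := Quot.map₂ (fun a b => a - b) (fun a _ _ h => Rel.sub_left a h)
    (fun _ _ c h => Rel.sub_right c h)

instance : Mul (FreeAlt k X) where
  mul := Quot.map₂ (· * ·) (fun a _ _ h => Rel.mul_left a h) (fun _ _ c h => Rel.mul_right c h)

instance : SMul k (FreeAlt k X) where
  smul t := Quot.map (fun a => t • a) (fun _ _ h => Rel.smul t h)

instance : SMul ℕ (FreeAlt k X) where
  smul n := Quot.map (fun a => n • a)
    (fun a b h => by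
      have h' := Rel.smul (n : k) h
      rwa [Nat.cast_smul_eq_nsmul, Nat.cast_smul_eq_nsmul] at h')

instance : SMul ℤ (FreeAlt k X) where
  smul n := Quot.map (fun a => n • a)
    (fun a b h => by
      have h' := Rel.smul (n : k) h
      rwa [Int.cast_smul_eq_zsmul, Int.cast_smul_eq_zsmul] at h')

instance : NonUnitalNonAssocRing (FreeAlt k X) :=
  Function.Surjective.nonUnitalNonAssocRing (Quot.mk (Rel k X)) Quot.mk_surjective rfl
    (fun _ _ => rfl) (fun _ _ => rfl) (fun _ => rfl) (fun _ _ => rfl) (fun _ _ => rfl)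
    (fun _ _ => rfl)

instance : Module k (FreeAlt k X) :=
  Function.Surjective.module k ⟨⟨Quot.mk (Rel k X), rfl⟩, fun _ _ => rfl⟩
    Quot.mk_surjective (fun _ _ => rfl)

instance : IsScalarTower k (FreeAlt k X) (FreeAlt k X) where
  smul_assoc := by
    rintro t ⟨a⟩ ⟨b⟩
    exact congrArg (Quot.mk (Rel k X)) (smul_assoc t a b)

instance : SMulCommClass k (FreeAlt k X) (FreeAlt k X) where
  smul_comm := by
    rintro t ⟨a⟩ ⟨b⟩
    exact congrArg (Quot.mk (Rel k X)) (smul_comm t a b)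

instance : IsAlternative (FreeAlt k X) where
  left_alt := by
    rintro ⟨a⟩ ⟨b⟩
    exact Quot.sound (Rel.left_alt a b)
  right_alt := by
    rintro ⟨a⟩ ⟨b⟩
    exact Quot.sound (Rel.right_alt a b)

end Structure

/-- The free generator of `F(X)` given by `x : X`. -/
def of (k : Type u) {X : Type v} [Field k] (x : X) : FreeAlt k X :=
  Quot.mk _ (FreeNonUnitalNonAssocAlgebra.of k x)

section Lift

variable (k : Type u) {X : Type v} [Field k]
variable {A : Type w} [NonUnitalNonAssocRing A] [Module k A] [IsScalarTower k A A]
  [SMulCommClass k A A] [IsAlternative A]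

theorem lift_rel (f : X → A) (a b : FreeNonUnitalNonAssocAlgebra k X) (h : Rel k X a b) :
    FreeNonUnitalNonAssocAlgebra.lift k f a = FreeNonUnitalNonAssocAlgebra.lift k f b := by
  induction h with
  | left_alt a b => simp only [map_mul, IsAlternative.left_alt]
  | right_alt a b => simp only [map_mul, IsAlternative.right_alt]
  | smul t _ ih => simp only [map_smul, ih]
  | add_right c _ ih => simp only [map_add, ih]
  | mul_left c _ ih => simp only [map_mul, ih]
  | mul_right c _ ih => simp only [map_mul, ih]

/-- The universal property of the free alternative algebra: maps from `X` to an alternative algebra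
`A` correspond to algebra homomorphisms `F(X) → A`, by restriction to the generators. -/
def lift : (X → A) ≃ (FreeAlt k X →ₙₐ[k] A) where
  toFun f :=
    { toFun := fun c => Quot.liftOn c (FreeNonUnitalNonAssocAlgebra.lift k f) (lift_rel k f)
      map_smul' := by rintro t ⟨a⟩; exact map_smul (FreeNonUnitalNonAssocAlgebra.lift k f) t a
      map_zero' := map_zero (FreeNonUnitalNonAssocAlgebra.lift k f)
      map_add' := by rintro ⟨a⟩ ⟨b⟩; exact map_add (FreeNonUnitalNonAssocAlgebra.lift k f) a b
      map_mul' := by rintro ⟨a⟩ ⟨b⟩; exact map_mul (FreeNonUnitalNonAssocAlgebra.lift k f) a b }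
  invFun F := fun x => F (of k x)
  left_inv f := by
    funext x
    exact FreeNonUnitalNonAssocAlgebra.lift_of_apply k f x
  right_inv F := by
    ext ⟨a⟩
    let q : FreeNonUnitalNonAssocAlgebra k X →ₙₐ[k] FreeAlt k X :=
      { toFun := Quot.mk (Rel k X)
        map_smul' := fun _ _ => rfl
        map_zero' := rfl
        map_add' := fun _ _ => rfl
        map_mul' := fun _ _ => rfl }
    exact DFunLike.congr_fun (FreeNonUnitalNonAssocAlgebra.lift_comp_of k (F.comp q)) a

theorem lift_of (f : X → A) (x : X) : lift k f (of k x) = f x :=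
  congrFun ((lift k).symm_apply_apply f) x

/-- The value `w(h₁, …, hₘ)` of a word `w = w(x₁, …, xₘ) ∈ F(x₁, …, xₘ)` at elements
`h₁, …, hₘ` of an alternative algebra: the image of `w` under the homomorphism with `xᵢ ↦ hᵢ`. -/
def eval {m : ℕ} (w : FreeAlt k (Fin m)) (h : Fin m → A) : A :=
  lift k h w

end Lift

end FreeAlt

/-- The category `Θ⁰` for the variety `Θ` of all alternative `k`-algebras: its objects are the free
alternative algebras `F(X)` on the finite subsets `X` of a fixed countable set of symbols (here `ℕ`),
its morphisms are all algebra homomorphisms between them. -/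
structure FreeAltCat (k : Type u) where
  gens : Finset ℕ

namespace FreeAltCat

/-- The algebra `F(X)`, for an object of the category. -/
abbrev alg {k : Type u} [Field k] (X : FreeAltCat k) : Type u :=
  FreeAlt k X.gens

instance (k : Type u) [Field k] : Category.{u} (FreeAltCat k) where
  Hom X Y := X.alg →ₙₐ[k] Y.alg
  id X := NonUnitalAlgHom.id k X.alg
  comp f g := NonUnitalAlgHom.comp g f

end FreeAltCat

section Inner

variable (C : Type v) [Category.{w} C]

/-- The group `𝔄` of all automorphisms of a category `C`: functors `C ⥤ C` with a two-sided
inverse functor (up to equality), under composition. -/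
abbrev CatAut : Type (max v w) :=
  Aut (Cat.of C)

/-- The subgroup `𝔜` of all inner automorphisms of a category `C`, that is, of the automorphisms
that are isomorphic as functors to the identity automorphism. -/
def innerAut : Subgroup (CatAut C) where
  carrier := {Φ | Nonempty (𝟭 C ≅ Φ.hom.toFunctor)}
  one_mem' := ⟨Iso.refl _⟩
  mul_mem' := by
    rintro Φ Ψ ⟨e⟩ ⟨e'⟩
    exact ⟨e' ≪≫ Functor.isoWhiskerLeft Ψ.hom.toFunctor e⟩
  inv_mem' := by
    rintro Φ ⟨e⟩
    have h : Φ.inv.toFunctor ⋙ Φ.hom.toFunctor = 𝟭 C :=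
      congrArg Cat.Hom.toFunctor Φ.inv_hom_id
    exact ⟨(eqToIso h).symm ≪≫ (Functor.isoWhiskerLeft Φ.inv.toFunctor e).symm⟩

instance innerAut_normal : (innerAut C).Normal where
  conj_mem := by
    rintro Φ ⟨e⟩ Ψ
    have h : Ψ.inv.toFunctor ⋙ Ψ.hom.toFunctor = 𝟭 C :=
      congrArg Cat.Hom.toFunctor Ψ.inv_hom_id
    exact ⟨(eqToIso h).symm ≪≫ Functor.isoWhiskerLeft Ψ.inv.toFunctor
      (Functor.isoWhiskerRight e Ψ.hom.toFunctor)⟩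

end Inner

/-- A system of words `W = {w₀, w_λ (λ ∈ k), w₊, w_·}`, one for each operation of the signature of
`k`-algebras, each in the free alternative algebra whose rank is the arity of the operation. -/
structure WordSystem (k : Type u) [Field k] where
  zero : FreeAlt k (Fin 0)
  smul : k → FreeAlt k (Fin 1)
  add : FreeAlt k (Fin 2)
  mul : FreeAlt k (Fin 2)

/-- A system of words `W` is admissible if for every free algebra `F = F(X)` of the category there is
an isomorphism `σ : F → F_W^*` that is the identity on `X`, where `F_W^*` is the set `F` with the
verbal operations defined by the words of `W`. -/
def WordSystem.IsAdmissible {k : Type u} [Field k] (W : WordSystem k) : Prop :=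
  ∀ X : FreeAltCat k, ∃ σ : X.alg ≃ X.alg,
    (∀ x : X.gens, σ (FreeAlt.of k x) = FreeAlt.of k x) ∧
    σ 0 = FreeAlt.eval k W.zero ![] ∧
    (∀ (c : k) (f : X.alg), σ (c • f) = FreeAlt.eval k (W.smul c) ![σ f]) ∧
    (∀ f g : X.alg, σ (f + g) = FreeAlt.eval k W.add ![σ f, σ g]) ∧
    (∀ f g : X.alg, σ (f * g) = FreeAlt.eval k W.mul ![σ f, σ g])

end

/-!
Every automorphism of the category of free alternative algebras is, up to an inner one, conjugation by
bijections of the free algebras that are semilinear over a field automorphism `φ` and either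
multiplicative or antimultiplicative. The pair (order of the product, `φ`) is what remains modulo inner
automorphisms.

For the classification of words, let `σ` be an isomorphism of `F(X)` onto the same set with the
operations given by `W`, fixing the generators. The word `w_c`, `c ≠ 0`, is invertible under
substitution. Words in one letter are polynomials without constant term (`FreeAlt.toPoly_injective`,
power associativity), so degrees show that `w_c = φ(c) x`, with `φ` multiplicative and injective. In
particular the powers of `φ(2)` are distinct, and the components of a free algebra are the eigenspaces
of scaling by `φ(2)` (`FreeAlt.mem_homogeneous_of_scale`). As the new sum and product are compatible
with the scalar `2`, their words are of degree one and two, which leaves `x₁ + x₂` and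
`a x₁x₂ + b x₂x₁`. The left alternative law for this product, evaluated in `2 × 2` matrices, forces
`a b = 0`. This is `WordSystem.IsVerbalIso.exists_isTwistSystem`. The converse is realized by twisted
automorphisms, which come from the universal property of `F(X)` applied to a copy of `F(X)` with
twisted operations (`FreeAlt.twist`).

An automorphism `G` of the category sends the algebra on one generator to such an algebra
(`FreeAltCat.exists_unique_generator`): otherwise two words in one letter would take arbitrary pairs of
values. Elements of `F(X)` are morphisms from that algebra, so `G` gives bijections
`F(X) → G(F(X))`. Corrected by a change of generators these are compatible with substitution, hence
carry the operations to verbal ones, and the classification applies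
(`FreeAltCat.exists_isTwistedConj`). The twists are unique, because a family of twisted bijections that
commutes with all homomorphisms consists of multiplications by one scalar
(`FreeAltCat.eq_one_of_natural`).
-/

noncomputable section

/-! ### Alternative algebras and the free alternative algebra -/

/-- Associative algebras are alternative. -/
instance IsAlternative.of_semigroup (A : Type*) [Semigroup A] : IsAlternative A where
  left_alt x y := mul_assoc x x y
  right_alt x y := (mul_assoc y x x).symm

/-- The linearized left alternative law. -/
theorem IsAlternative.mul_add_mul_mul {A : Type*} [NonUnitalNonAssocRing A] [IsAlternative A]
    (a b y : A) : (a * b + b * a) * y = a * (b * y) + b * (a * y) := by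
  have h := left_alt (a + b) y
  have ha := left_alt a y
  have hb := left_alt b y
  simp only [add_mul, mul_add] at h ⊢
  rw [ha, hb] at h
  have h' : a * (a * y) + b * (b * y) + (a * b * y + b * a * y) =
      a * (a * y) + b * (b * y) + (a * (b * y) + b * (a * y)) := by
    convert h using 1 <;> abel
  exact add_left_cancel h'

namespace FreeAlt

variable {k : Type u} [Field k] {X : Type v}

theorem hom_ext {A : Type w} [NonUnitalNonAssocRing A] [Module k A] [IsScalarTower k A A]
    [SMulCommClass k A A] [IsAlternative A] {f g : FreeAlt k X →ₙₐ[k] A}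
    (h : ∀ x, f (of k x) = g (of k x)) : f = g :=
  (lift k).symm.injective (funext h)

@[elab_as_elim]
theorem induction {p : FreeAlt k X → Prop} (f : FreeAlt k X) (zero : p 0)
    (of : ∀ x, p (of k x)) (add : ∀ f g, p f → p g → p (f + g))
    (smul : ∀ (c : k) f, p f → p (c • f)) (mul : ∀ f g, p f → p g → p (f * g)) : p f := by
  let S : NonUnitalSubalgebra k (FreeAlt k X) :=
    { carrier := {f | p f}
      zero_mem' := zero
      add_mem' := fun {a b} => add a b
      smul_mem' := fun c a => smul c a
      mul_mem' := fun {a b} => mul a b }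
  have : IsAlternative S :=
    ⟨fun x y => Subtype.ext (IsAlternative.left_alt (x : FreeAlt k X) y),
      fun x y => Subtype.ext (IsAlternative.right_alt (x : FreeAlt k X) y)⟩
  let F : FreeAlt k X →ₙₐ[k] S := lift k fun x => ⟨FreeAlt.of k x, of x⟩
  have hF : (NonUnitalSubalgebraClass.subtype S).comp F = NonUnitalAlgHom.id k _ :=
    hom_ext fun x => congrArg Subtype.val (lift_of k _ x)
  have := (F f).2
  rwa [show ((F f : S) : FreeAlt k X) = f from DFunLike.congr_fun hF f] at this

/-- A set that contains the free generators and is closed under multiplication spans the free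
algebra. -/
theorem mem_span_of_mul_mem {S : Set (FreeAlt k X)} (hof : ∀ x, of k x ∈ S)
    (hmul : ∀ a ∈ S, ∀ b ∈ S, a * b ∈ S) (f : FreeAlt k X) : f ∈ Submodule.span k S := by
  induction f using FreeAlt.induction with
  | zero => exact zero_mem _
  | of i => exact Submodule.subset_span (hof i)
  | add f g hf hg => exact add_mem hf hg
  | smul c f hf => exact Submodule.smul_mem _ c hf
  | mul f g hf hg =>
    induction hf, hg using Submodule.span_induction₂ with
    | mem_mem a b ha hb => exact Submodule.subset_span (hmul a ha b hb)
    | zero_left => simp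
    | zero_right => simp
    | add_left a b c _ _ _ ha hb => rw [add_mul]; exact add_mem ha hb
    | add_right a b c _ _ _ ha hb => rw [mul_add]; exact add_mem ha hb
    | smul_left r a b _ _ h => rw [smul_mul_assoc]; exact Submodule.smul_mem _ r h
    | smul_right r a b _ _ h => rw [mul_smul_comm]; exact Submodule.smul_mem _ r h

instance (X : Type v) [IsEmpty X] : Subsingleton (FreeAlt k X) := by
  have h : ∀ f : FreeAlt k X, f = 0 := fun f => by
    induction f using FreeAlt.induction with
    | zero => rfl
    | of x => exact isEmptyElim x
    | add f g hf hg => rw [hf, hg, add_zero]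
    | smul c f hf => rw [hf, smul_zero]
    | mul f g hf hg => rw [hf, zero_mul]
  exact ⟨fun f g => (h f).trans (h g).symm⟩

section Lift

variable {A : Type*} [NonUnitalNonAssocRing A] [Module k A] [IsScalarTower k A A]
  [SMulCommClass k A A] [IsAlternative A]
variable {B : Type*} [NonUnitalNonAssocRing B] [Module k B] [IsScalarTower k B B]
  [SMulCommClass k B B] [IsAlternative B]

theorem map_lift (F : A →ₙₐ[k] B) (g : X → A) (f : FreeAlt k X) :
    F (lift k g f) = lift k (fun x => F (g x)) f :=
  DFunLike.congr_fun (hom_ext (f := F.comp (lift k g)) fun x => by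
    simp [lift_of]) f

theorem lift_of_self (f : FreeAlt k X) : lift k (of k) f = f :=
  DFunLike.congr_fun (hom_ext (g := NonUnitalAlgHom.id k _) fun x => by simp [lift_of]) f

theorem map_eval {m : ℕ} (F : A →ₙₐ[k] B) (w : FreeAlt k (Fin m)) (g : Fin m → A) :
    F (eval k w g) = eval k w (fun i => F (g i)) :=
  map_lift F g w

@[simp]
theorem eval_of {m : ℕ} (g : Fin m → A) (i : Fin m) : eval k (of k i) g = g i :=
  lift_of k g i

@[simp]
theorem eval_add {m : ℕ} (g : Fin m → A) (v w : FreeAlt k (Fin m)) :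
    eval k (v + w) g = eval k v g + eval k w g :=
  map_add (lift k g) v w

@[simp]
theorem eval_mul {m : ℕ} (g : Fin m → A) (v w : FreeAlt k (Fin m)) :
    eval k (v * w) g = eval k v g * eval k w g :=
  map_mul (lift k g) v w

@[simp]
theorem eval_smul {m : ℕ} (g : Fin m → A) (c : k) (w : FreeAlt k (Fin m)) :
    eval k (c • w) g = c • eval k w g :=
  map_smul (lift k g) c w

@[simp]
theorem eval_zero {m : ℕ} (g : Fin m → A) : eval k (0 : FreeAlt k (Fin m)) g = 0 :=
  map_zero (lift k g)

/-- A word is determined by its value at distinct free generators. -/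
theorem eval_of_injective {m : ℕ} {e : Fin m → X} (he : Function.Injective e) :
    Function.Injective fun w : FreeAlt k (Fin m) => eval k w fun i => of k (e i) := by
  classical
  refine Function.LeftInverse.injective
    (g := lift k fun x => if h : ∃ i, e i = x then of k h.choose else 0) fun w => ?_
  rw [map_eval]
  conv_rhs => rw [← lift_of_self w]
  refine congrArg (fun g => lift k g w) (funext fun i => ?_)
  have h : ∃ j, e j = e i := ⟨i, rfl⟩
  rw [lift_of, dif_pos h, he h.choose_spec]

end Lift

/-! ### Words in one letter -/

section OneLetter

variable {A : Type*} [NonUnitalNonAssocRing A]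

/-- The right-normed power `x ^ (n + 1) = x (x (⋯ x))` of an element of an algebra that need not
have a unit, so that the exponent is shifted by one. -/
def powSucc (x : A) (n : ℕ) : A :=
  (x * ·)^[n] x

theorem powSucc_succ (x : A) (n : ℕ) : powSucc x (n + 1) = x * powSucc x n :=
  Function.iterate_succ_apply' _ _ _

/-- Left multiplication by a power of `x` is the power of left multiplication by `x`. The linearized
left alternative law gives `2 L_{x ^ (n + 1)} = L_x L_{x ^ n} + L_{x ^ n} L_x`. -/
theorem powSucc_mul [IsAlternative A] [IsAddTorsionFree A] (x : A) (n : ℕ) (y : A) :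
    powSucc x n * y = (x * ·)^[n + 1] y := by
  induction n generalizing y with
  | zero => rfl
  | succ n ih =>
    have hcomm : powSucc x n * x = x * powSucc x n := by
      rw [ih, ← powSucc_succ]; rfl
    have h := IsAlternative.mul_add_mul_mul x (powSucc x n) y
    rw [hcomm, ← powSucc_succ, ih, ih, ← Function.iterate_succ_apply (x * ·),
      ← Function.iterate_succ_apply' (x * ·), add_mul, ← two_nsmul, ← two_nsmul] at h
    exact nsmul_right_injective two_ne_zero h

theorem powSucc_mul_powSucc [IsAlternative A] [IsAddTorsionFree A] (x : A) (m n : ℕ) :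
    powSucc x m * powSucc x n = powSucc x (m + n + 1) := by
  rw [powSucc_mul, powSucc, powSucc, ← Function.iterate_add_apply, add_right_comm]

open Polynomial in
/-- The image in `k[X]` of a word in one letter, under the homomorphism that sends the letter to the
variable. -/
def toPoly : FreeAlt k (Fin 1) →ₙₐ[k] k[X] :=
  lift k fun _ => Polynomial.X

theorem toPoly_of (i : Fin 1) : toPoly (of k i) = Polynomial.X :=
  lift_of k _ i

theorem eval_eq_toPoly_comp (w : FreeAlt k (Fin 1)) (q : Polynomial k) :
    eval k w ![q] = (toPoly w).comp q := by
  have h := map_lift (X := Fin 1) ((Polynomial.aeval q : Polynomial k →ₐ[k] Polynomial k) :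
    Polynomial k →ₙₐ[k] Polynomial k) (fun _ => Polynomial.X) w
  have hq : (![q] : Fin 1 → Polynomial k) =
      fun _ => Polynomial.aeval q (Polynomial.X : Polynomial k) := by
    funext i
    rw [Polynomial.aeval_X, Subsingleton.elim i 0]
    rfl
  rw [hq]
  exact h.symm

theorem toPoly_coeff_zero (w : FreeAlt k (Fin 1)) : (toPoly w).coeff 0 = 0 := by
  induction w using FreeAlt.induction with
  | zero => simp
  | of x => simp [toPoly_of]
  | add f g hf hg => simp [hf, hg]
  | smul c f hf => simp [hf]
  | mul f g hf hg => simp [hf]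

theorem toPoly_powSucc (n : ℕ) : toPoly (powSucc (of k 0) n) = Polynomial.X ^ (n + 1) := by
  induction n with
  | zero => exact (toPoly_of 0).trans (pow_one _).symm
  | succ n ih => rw [powSucc_succ, map_mul, ih, toPoly_of, pow_succ' _ (n + 1)]

variable [CharZero k]

instance isAddTorsionFree : IsAddTorsionFree (FreeAlt k X) := by
  refine ⟨fun n hn a b h => ?_⟩
  have h' : (n : k) • a = (n : k) • b := by
    simpa only [Nat.cast_smul_eq_nsmul] using h
  exact smul_right_injective _ (Nat.cast_ne_zero.mpr hn) h'

theorem mem_span_powSucc (f : FreeAlt k (Fin 1)) :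
    f ∈ Submodule.span k (Set.range (powSucc (of k (0 : Fin 1)))) := by
  refine mem_span_of_mul_mem (S := Set.range _) (fun x => ⟨0, ?_⟩) ?_ f
  · rw [Subsingleton.elim x 0]
    rfl
  rintro _ ⟨m, rfl⟩ _ ⟨n, rfl⟩
  exact ⟨m + n + 1, (powSucc_mul_powSucc _ m n).symm⟩

/-- The free alternative algebra on one letter is the algebra of polynomials without constant term:
the powers of the letter span it, because they multiply as powers do. -/
theorem toPoly_injective : Function.Injective (toPoly (k := k)) := by
  let L : Polynomial k →ₗ[k] FreeAlt k (Fin 1) :=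
    (Polynomial.basisMonomials k).constr k fun n => powSucc (of k 0) (n - 1)
  have hL (n : ℕ) : L (Polynomial.X ^ (n + 1)) = powSucc (of k 0) n := by
    have h : Polynomial.X ^ (n + 1) = Polynomial.basisMonomials k (n + 1) := by
      rw [Polynomial.X_pow_eq_monomial, Polynomial.coe_basisMonomials]
    rw [h]
    exact (Polynomial.basisMonomials k).constr_basis k _ (n + 1)
  let T : FreeAlt k (Fin 1) →ₗ[k] Polynomial k := (toPoly : FreeAlt k (Fin 1) →ₙₐ[k] Polynomial k)
  refine Function.LeftInverse.injective (g := L) fun f => ?_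
  have hLT : Set.EqOn (L ∘ₗ T)
      (LinearMap.id : FreeAlt k (Fin 1) →ₗ[k] FreeAlt k (Fin 1))
      (Set.range (powSucc (of k (0 : Fin 1)))) := by
    rintro _ ⟨n, rfl⟩
    exact (congrArg L (toPoly_powSucc n)).trans (hL n)
  exact LinearMap.eqOn_span (f := L ∘ₗ T)
    (g := (LinearMap.id : FreeAlt k (Fin 1) →ₗ[k] FreeAlt k (Fin 1))) hLT (mem_span_powSucc f)

/-- A word in one letter that has a right inverse under substitution is linear: degrees of
polynomials multiply under substitution. -/
theorem exists_eq_smul_of_comp_eq_X {w : FreeAlt k (Fin 1)} {q : Polynomial k}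
    (h : (toPoly w).comp q = Polynomial.X) : ∃ a : k, w = a • of k 0 := by
  have hdeg := congrArg Polynomial.natDegree h
  rw [Polynomial.natDegree_comp, Polynomial.natDegree_X] at hdeg
  have h1 := Nat.eq_one_of_mul_eq_one_right hdeg
  refine ⟨(toPoly w).coeff 1, toPoly_injective ?_⟩
  rw [map_smul, toPoly_of, Polynomial.smul_eq_C_mul]
  conv_lhs => rw [Polynomial.eq_X_add_C_of_natDegree_le_one h1.le, toPoly_coeff_zero]
  simp

end OneLetter

/-! ### Homogeneous components -/

section Homogeneous

/-- `IsMonomial d f` says that `f` is a nonassociative monomial of degree `d` in the free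
generators. -/
inductive IsMonomial : ℕ → FreeAlt k X → Prop
  | of (x : X) : IsMonomial 1 (of k x)
  | mul {m n : ℕ} {f g : FreeAlt k X} : IsMonomial m f → IsMonomial n g → IsMonomial (m + n) (f * g)

theorem IsMonomial.pos {d : ℕ} {f : FreeAlt k X} (h : IsMonomial d f) : 0 < d := by
  induction h with
  | of => exact one_pos
  | mul _ _ h _ => omega

theorem IsMonomial.eq_of {d : ℕ} {f : FreeAlt k X} (h : IsMonomial d f) (hd : d = 1) :
    ∃ x, f = FreeAlt.of k x := by
  cases h with
  | of x => exact ⟨x, rfl⟩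
  | mul h h' => have := h.pos; have := h'.pos; omega

theorem IsMonomial.eq_of_mul_of {d : ℕ} {f : FreeAlt k X} (h : IsMonomial d f) (hd : d = 2) :
    ∃ x y, f = FreeAlt.of k x * FreeAlt.of k y := by
  cases h with
  | of x => omega
  | mul h h' =>
    have := h.pos
    have := h'.pos
    obtain ⟨x, rfl⟩ := h.eq_of (by omega)
    obtain ⟨y, rfl⟩ := h'.eq_of (by omega)
    exact ⟨x, y, rfl⟩

/-- The endomorphism of `F(X)` that multiplies every free generator by `c`. -/
def scale (c : k) : FreeAlt k X →ₙₐ[k] FreeAlt k X :=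
  lift k fun x => c • of k x

theorem scale_of (c : k) (x : X) : scale c (of k x) = c • of k x :=
  lift_of k _ x

theorem IsMonomial.scale {d : ℕ} {f : FreeAlt k X} (h : IsMonomial d f) (c : k) :
    scale c f = c ^ d • f := by
  induction h with
  | of x => rw [scale_of, pow_one]
  | mul _ _ hf hg => rw [map_mul, hf, hg, smul_mul_smul_comm, pow_add]

variable (k X) in
/-- The component of degree `d` of the free alternative algebra. -/
def homogeneous (d : ℕ) : Submodule k (FreeAlt k X) :=
  Submodule.span k {f | IsMonomial d f}

theorem mem_iSup_homogeneous (f : FreeAlt k X) : f ∈ ⨆ d, homogeneous k X d := by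
  have key : ⨆ d, homogeneous k X d = Submodule.span k {f | ∃ d, IsMonomial d f} := by
    simp only [homogeneous, Submodule.iSup_span, ← Set.ofPred_exists]
  rw [key]
  refine mem_span_of_mul_mem (S := {f | ∃ d, IsMonomial d f}) (fun x => ⟨1, .of x⟩) ?_ f
  rintro a ⟨m, ha⟩ b ⟨n, hb⟩
  exact ⟨m + n, ha.mul hb⟩

/-- If the powers of `c` are distinct, the components of `F(X)` are the eigenspaces of scaling by
`c`, since they lie in these and eigenspaces are independent. -/
theorem mem_homogeneous_of_scale {c : k} (hc : Function.Injective fun n : ℕ => c ^ n) {d : ℕ}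
    {f : FreeAlt k X} (h : scale c f = c ^ d • f) : f ∈ homogeneous k X d := by
  let T : Module.End k (FreeAlt k X) := (scale c : FreeAlt k X →ₙₐ[k] FreeAlt k X)
  have hle (n : ℕ) : homogeneous k X n ≤ T.eigenspace (c ^ n) :=
    Submodule.span_le.mpr fun g hg => Module.End.mem_eigenspace_iff.mpr (hg.scale c)
  have hind : iSupIndep fun n : ℕ => T.eigenspace (c ^ n) :=
    (Module.End.eigenspaces_iSupIndep T).comp hc
  have hf := mem_iSup_homogeneous f
  rw [iSup_split_single _ d] at hf
  obtain ⟨a, ha, b, hb, rfl⟩ := Submodule.mem_sup.mp hf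
  have hb' : b ∈ ⨆ (n) (_ : n ≠ d), T.eigenspace (c ^ n) :=
    iSup₂_mono (fun n _ => hle n) hb
  have hb'' : b ∈ T.eigenspace (c ^ d) := by
    have : a + b ∈ T.eigenspace (c ^ d) := Module.End.mem_eigenspace_iff.mpr h
    exact (Submodule.add_mem_iff_right _ (hle d ha)).mp this
  rw [Submodule.disjoint_def.mp (hind d) b hb'' hb', add_zero]
  exact ha

theorem homogeneous_one_le :
    homogeneous k X 1 ≤ Submodule.span k (Set.range (of k)) :=
  Submodule.span_mono fun _ hf => (hf.eq_of rfl).imp fun _ h => h.symm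

theorem homogeneous_two_le :
    homogeneous k X 2 ≤ Submodule.span k (Set.range fun p : X × X => of k p.1 * of k p.2) :=
  Submodule.span_mono fun f hf => by
    obtain ⟨x, y, h⟩ := hf.eq_of_mul_of rfl
    exact ⟨(x, y), h.symm⟩

end Homogeneous

end FreeAlt

/-! ### Semilinear isomorphisms and anti-isomorphisms -/

theorem perm_fin_two (e : Equiv.Perm (Fin 2)) : e = 1 ∨ e = Equiv.swap 0 1 := by
  revert e; decide

/-- The product of two elements in the order prescribed by `e`: the product `f * g` for `e = 1`, and
the opposite product `g * f` for the transposition. -/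
def twistMul {A : Type*} [Mul A] (e : Equiv.Perm (Fin 2)) (f g : A) : A :=
  ![f, g] (e 0) * ![f, g] (e 1)

@[simp]
theorem twistMul_one {A : Type*} [Mul A] (f g : A) : twistMul 1 f g = f * g := rfl

@[simp]
theorem twistMul_swap {A : Type*} [Mul A] (f g : A) : twistMul (Equiv.swap 0 1) f g = g * f := by
  simp [twistMul]

section Distrib

variable {A : Type*} [NonUnitalNonAssocRing A] (e : Equiv.Perm (Fin 2))

theorem twistMul_add (a b c : A) : twistMul e a (b + c) = twistMul e a b + twistMul e a c := by
  rcases perm_fin_two e with rfl | rfl <;> simp [mul_add, add_mul]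

theorem add_twistMul (a b c : A) : twistMul e (a + b) c = twistMul e a c + twistMul e b c := by
  rcases perm_fin_two e with rfl | rfl <;> simp [mul_add, add_mul]

theorem twistMul_zero (a : A) : twistMul e a 0 = 0 := by
  rcases perm_fin_two e with rfl | rfl <;> simp

theorem zero_twistMul (a : A) : twistMul e 0 a = 0 := by
  rcases perm_fin_two e with rfl | rfl <;> simp

theorem twistMul_smul_smul {k : Type*} [Field k] [Module k A] [IsScalarTower k A A]
    [SMulCommClass k A A] (c d : k) (a b : A) :
    twistMul e (c • a) (d • b) = (c * d) • twistMul e a b := by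
  rcases perm_fin_two e with rfl | rfl <;> simp [smul_mul_smul_comm, mul_comm]

end Distrib

/-- A map that is additive, semilinear over the field automorphism `φ`, and multiplicative
(for `e = 1`) or antimultiplicative (for the transposition `e`). -/
structure IsTwisted {k : Type*} [Field k] {A B : Type*} [NonUnitalNonAssocRing A] [Module k A]
    [NonUnitalNonAssocRing B] [Module k B] (e : Equiv.Perm (Fin 2)) (φ : RingAut k)
    (s : A → B) : Prop where
  map_add (f g : A) : s (f + g) = s f + s g
  map_smul (c : k) (f : A) : s (c • f) = φ c • s f
  map_mul (f g : A) : s (f * g) = twistMul e (s f) (s g)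

namespace IsTwisted

variable {k : Type u} [Field k] {A B C : Type*} [NonUnitalNonAssocRing A] [Module k A]
  [NonUnitalNonAssocRing B] [Module k B] [NonUnitalNonAssocRing C] [Module k C]
  {e e' : Equiv.Perm (Fin 2)} {φ φ' : RingAut k}

theorem map_zero {s : A → B} (hs : IsTwisted e φ s) : s 0 = 0 := by
  have := hs.map_smul 0 0
  rwa [zero_smul, _root_.map_zero, zero_smul] at this

theorem comp {s : B → C} {t : A → B} (hs : IsTwisted e φ s) (ht : IsTwisted e' φ' t) :
    IsTwisted (e * e') (φ * φ') (s ∘ t) where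
  map_add f g := by simp only [Function.comp, ht.map_add, hs.map_add]
  map_smul c f := by simp only [Function.comp, ht.map_smul, hs.map_smul]; rfl
  map_mul f g := by
    simp only [Function.comp, ht.map_mul]
    rcases perm_fin_two e with rfl | rfl <;> rcases perm_fin_two e' with rfl | rfl <;>
      simp [hs.map_mul]

theorem symm {s : A ≃ B} (hs : IsTwisted e φ s) : IsTwisted e⁻¹ φ⁻¹ s.symm where
  map_add f g := by
    apply s.injective
    simp [hs.map_add]
  map_smul c f := by
    apply s.injective
    rw [hs.map_smul, s.apply_symm_apply, s.apply_symm_apply, ← RingAut.mul_apply, mul_inv_cancel,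
      RingAut.one_apply]
  map_mul f g := by
    apply s.injective
    rcases perm_fin_two e with rfl | rfl <;> simp [hs.map_mul]

theorem of_hom (F : A →ₙₐ[k] B) : IsTwisted 1 (1 : RingAut k) F where
  map_add f g := _root_.map_add F f g
  map_smul c f := _root_.map_smul F c f
  map_mul f g := _root_.map_mul F f g

/-- A twisted map with trivial twists is a homomorphism. -/
def toHom {s : A → B} (hs : IsTwisted 1 (1 : RingAut k) s) : A →ₙₐ[k] B where
  toFun := s
  map_smul' := hs.map_smul
  map_zero' := hs.map_zero
  map_add' := hs.map_add
  map_mul' := hs.map_mul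

theorem eq_of_eq_on_generators {X : Type v} {s t : FreeAlt k X → B} (hs : IsTwisted e φ s)
    (ht : IsTwisted e φ t) (h : ∀ x, s (FreeAlt.of k x) = t (FreeAlt.of k x)) (f : FreeAlt k X) :
    s f = t f := by
  induction f using FreeAlt.induction with
  | zero => rw [hs.map_zero, ht.map_zero]
  | of x => exact h x
  | add f g hf hg => rw [hs.map_add, ht.map_add, hf, hg]
  | smul c f hf => rw [hs.map_smul, ht.map_smul, hf]
  | mul f g hf hg => rw [hs.map_mul, ht.map_mul, hf, hg]

end IsTwisted

/-- The additive group of an algebra `A`, with scalars acting through `φ` and with the product taken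
in the order prescribed by `e`. -/
def Twist {k : Type*} [Field k] (_e : Equiv.Perm (Fin 2)) (_φ : RingAut k) (A : Type*) : Type _ :=
  A

namespace Twist

variable {k : Type u} [Field k] (e : Equiv.Perm (Fin 2)) (φ : RingAut k) (A : Type*)
  [NonUnitalNonAssocRing A] [Module k A]

instance : AddCommGroup (Twist e φ A) :=
  inferInstanceAs (AddCommGroup A)

instance : NonUnitalNonAssocRing (Twist e φ A) where
  __ := (inferInstance : AddCommGroup (Twist e φ A))
  mul := twistMul (A := A) e
  left_distrib := twistMul_add (A := A) e
  right_distrib := add_twistMul (A := A) e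
  zero_mul := zero_twistMul (A := A) e
  mul_zero := twistMul_zero (A := A) e

instance : Module k (Twist e φ A) :=
  Module.compHom A (φ : k →+* k)

/-- The identity map from `Twist e φ A` to `A`. -/
def toBase (A : Type*) : Twist e φ A → A := id

theorem isTwisted_toBase : IsTwisted e φ (toBase e φ A) where
  map_add _ _ := rfl
  map_smul _ _ := rfl
  map_mul _ _ := rfl

theorem toBase_injective {A : Type*} : Function.Injective (toBase e φ A) := fun _ _ h => h

instance [IsScalarTower k A A] [SMulCommClass k A A] :
    IsScalarTower k (Twist e φ A) (Twist e φ A) where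
  smul_assoc c a b := by
    have h := isTwisted_toBase e φ A
    apply toBase_injective
    simp only [smul_eq_mul, h.map_mul, h.map_smul]
    rcases perm_fin_two e with rfl | rfl <;> simp [smul_mul_assoc, mul_smul_comm]

instance [IsScalarTower k A A] [SMulCommClass k A A] :
    SMulCommClass k (Twist e φ A) (Twist e φ A) where
  smul_comm c a b := by
    have h := isTwisted_toBase e φ A
    apply toBase_injective
    simp only [smul_eq_mul, h.map_mul, h.map_smul]
    rcases perm_fin_two e with rfl | rfl <;> simp [smul_mul_assoc, mul_smul_comm]

instance [IsAlternative A] : IsAlternative (Twist e φ A) where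
  left_alt a b := by
    have h := isTwisted_toBase e φ A
    apply toBase_injective
    simp only [h.map_mul]
    rcases perm_fin_two e with rfl | rfl
    · simp [IsAlternative.left_alt]
    · simp [IsAlternative.right_alt]
  right_alt a b := by
    have h := isTwisted_toBase e φ A
    apply toBase_injective
    simp only [h.map_mul]
    rcases perm_fin_two e with rfl | rfl
    · simp [IsAlternative.right_alt]
    · simp [IsAlternative.left_alt]

end Twist

namespace FreeAlt

variable {k : Type u} [Field k] {X : Type v}

/-- The twisted endomorphism of `F(X)` that fixes the free generators. -/
def twistMap (e : Equiv.Perm (Fin 2)) (φ : RingAut k) (f : FreeAlt k X) : FreeAlt k X :=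
  Twist.toBase e φ _ (lift k (A := Twist e φ (FreeAlt k X)) (of k) f)

theorem isTwisted_twistMap (e : Equiv.Perm (Fin 2)) (φ : RingAut k) :
    IsTwisted e φ (twistMap (X := X) e φ) := by
  have h := (Twist.isTwisted_toBase e φ (FreeAlt k X)).comp
    (IsTwisted.of_hom (lift k (A := Twist e φ (FreeAlt k X)) (of k)))
  rwa [mul_one, mul_one] at h

theorem twistMap_of (e : Equiv.Perm (Fin 2)) (φ : RingAut k) (x : X) :
    twistMap e φ (of k x) = of k x :=
  lift_of k (A := Twist e φ (FreeAlt k X)) _ x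

theorem twistMap_twistMap {e e' : Equiv.Perm (Fin 2)} {φ φ' : RingAut k} (he : e' * e = 1)
    (hφ : φ' * φ = 1) (f : FreeAlt k X) : twistMap e' φ' (twistMap e φ f) = f := by
  have h := (isTwisted_twistMap (X := X) e' φ').comp (isTwisted_twistMap e φ)
  rw [he, hφ] at h
  exact h.eq_of_eq_on_generators (IsTwisted.of_hom (NonUnitalAlgHom.id k _))
    (fun x => by simp [twistMap_of]) f

/-- The twisted automorphism of `F(X)` that fixes the free generators. -/
def twist (e : Equiv.Perm (Fin 2)) (φ : RingAut k) : FreeAlt k X ≃ FreeAlt k X where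
  toFun := twistMap e φ
  invFun := twistMap e⁻¹ φ⁻¹
  left_inv := twistMap_twistMap (inv_mul_cancel e) (inv_mul_cancel φ)
  right_inv := twistMap_twistMap (mul_inv_cancel e) (mul_inv_cancel φ)

theorem isTwisted_twist (e : Equiv.Perm (Fin 2)) (φ : RingAut k) :
    IsTwisted e φ (twist (X := X) e φ) :=
  isTwisted_twistMap e φ

theorem twist_of (e : Equiv.Perm (Fin 2)) (φ : RingAut k) (x : X) :
    twist e φ (of k x) = of k x :=
  twistMap_of e φ x

end FreeAlt

/-! ### Verbal operations and the classification of systems of words -/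

namespace FreeAlt

variable {k : Type u} [Field k] {X : Type v}

section Eval

variable {A : Type*} [NonUnitalNonAssocRing A] [Module k A] [IsScalarTower k A A]
  [SMulCommClass k A A] [IsAlternative A]
variable {B : Type*} [NonUnitalNonAssocRing B] [Module k B] [IsScalarTower k B B]
  [SMulCommClass k B B] [IsAlternative B]

theorem map_eval_one (F : A →ₙₐ[k] B) (w : FreeAlt k (Fin 1)) (a : A) :
    F (eval k w ![a]) = eval k w ![F a] := by
  rw [map_eval]
  congr 1
  funext i
  rw [Subsingleton.elim i 0]
  rfl

theorem eval_scale_two (c : k) (w : FreeAlt k (Fin 2)) (a b : A) :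
    eval k (scale c w) ![a, b] = eval k w ![c • a, c • b] := by
  rw [eval, scale, map_lift, eval]
  congr 2
  funext i
  fin_cases i <;> simp [lift_of]

/-- The homomorphism to `A` that sends one generator `x` to `a` and all others to `b`. -/
def liftPair (x : X) (a b : A) : FreeAlt k X →ₙₐ[k] A :=
  open Classical in lift k fun z => if z = x then a else b

theorem liftPair_left (x : X) (a b : A) : liftPair x a b (of k x) = a := by
  simp [liftPair, lift_of]

theorem liftPair_right {x y : X} (h : x ≠ y) (a b : A) : liftPair x a b (of k y) = b := by
  simp [liftPair, lift_of, h.symm]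

end Eval

theorem eval_injective_one (x : X) :
    Function.Injective fun w : FreeAlt k (Fin 1) => eval k w ![of k x] := by
  convert eval_of_injective (k := k) (Function.injective_of_subsingleton fun _ : Fin 1 => x) with w i
  rw [Subsingleton.elim i 0]
  rfl

theorem eval_injective_two {x y : X} (h : x ≠ y) :
    Function.Injective fun w : FreeAlt k (Fin 2) => eval k w ![of k x, of k y] := by
  have he : Function.Injective ![x, y] := by
    intro i j hij
    fin_cases i <;> fin_cases j <;> simp_all [eq_comm]
  convert eval_of_injective (k := k) he with w i
  fin_cases i <;> rfl

theorem of_ne_zero (x : X) : of k x ≠ 0 := fun h => by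
  have := congrArg (liftPair x (Polynomial.X : Polynomial k) 0) h
  rw [liftPair_left, map_zero] at this
  exact Polynomial.X_ne_zero this

theorem of_mul_of_ne_zero (x : X) : of k x * of k x ≠ 0 := fun h => by
  have := congrArg (liftPair x (Polynomial.X : Polynomial k) 0) h
  rw [map_mul, liftPair_left, map_zero] at this
  exact mul_self_ne_zero.mpr Polynomial.X_ne_zero this

/-- The products `x y` and `y x` of distinct generators are linearly independent: the matrix units
`E₀₀`, `E₀₁` separate them, since `E₀₀ E₀₁ = E₀₁` and `E₀₁ E₀₀ = 0`. -/
theorem eq_zero_of_smul_mul_eq_smul_mul {x y : X} (h : x ≠ y) {a b : k}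
    (hab : a • (of k x * of k y) = b • (of k y * of k x)) : a = 0 ∧ b = 0 := by
  have key {x y : X} (h : x ≠ y) {a b : k}
      (hab : a • (of k x * of k y) = b • (of k y * of k x)) : a = 0 := by
    have := congrArg (liftPair x (Matrix.single 0 0 1 : Matrix (Fin 2) (Fin 2) k)
      (Matrix.single 0 1 1)) hab
    simp only [map_smul, map_mul, liftPair_left, liftPair_right h] at this
    simpa using congrFun (congrFun this 0) 1
  exact ⟨key h hab, key h.symm hab.symm⟩

/-- The product `m(x, y) = a x y + b y x` satisfies the left alternative law only if `a b = 0`: in an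
associative algebra the law amounts to `a b [x, [x, y]] = 0`, and the double commutator does not
vanish on matrix units. -/
theorem mul_eq_zero_of_left_alt {x y : X} (h : x ≠ y) {a b : k}
    (m : FreeAlt k X → FreeAlt k X → FreeAlt k X) (hm : ∀ f g, m f g = a • (f * g) + b • (g * f))
    (halt : m (m (of k x) (of k x)) (of k y) = m (of k x) (m (of k x) (of k y))) : a * b = 0 := by
  have := congrArg (liftPair x (Matrix.single 0 0 1 : Matrix (Fin 2) (Fin 2) k)
    (Matrix.single 0 1 1)) halt
  simp only [hm, map_add, map_smul, map_mul, liftPair_left, liftPair_right h] at this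
  have h2 := congrFun (congrFun this 0) 1
  simp [mul_add, add_mul] at h2
  rcases h2 with h2 | h2 <;> simp [h2]

end FreeAlt

namespace WordSystem

open FreeAlt

variable {k : Type u} [Field k] {X : Type v}

/-- A bijection `σ` of `F(X)` that fixes the free generators and is an isomorphism from `F(X)` onto
the same set with the operations given by the words of `W`. -/
structure IsVerbalIso (W : WordSystem k) (σ : FreeAlt k X ≃ FreeAlt k X) : Prop where
  map_of (x : X) : σ (of k x) = of k x
  map_zero : σ 0 = eval k W.zero ![]
  map_smul (c : k) (f : FreeAlt k X) : σ (c • f) = eval k (W.smul c) ![σ f]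
  map_add (f g : FreeAlt k X) : σ (f + g) = eval k W.add ![σ f, σ g]
  map_mul (f g : FreeAlt k X) : σ (f * g) = eval k W.mul ![σ f, σ g]

/-- The words of the system `W` are `0`, `φ(c) x₁`, `x₁ + x₂`, and `α x₁ x₂` or `α x₂ x₁` according
to `e`. -/
structure IsTwistSystem (W : WordSystem k) (e : Equiv.Perm (Fin 2)) (φ : RingAut k) (α : k) :
    Prop where
  smul_eq (c : k) : W.smul c = φ c • of k 0
  add_eq : W.add = of k 0 + of k 1
  mul_eq : W.mul = α • twistMul e (of k 0) (of k 1)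

namespace IsVerbalIso

variable {W : WordSystem k} {σ : FreeAlt k X ≃ FreeAlt k X}

theorem apply_zero (h : W.IsVerbalIso σ) : σ 0 = 0 := by
  rw [h.map_zero, Subsingleton.elim W.zero 0, eval_zero]

/-- The word for multiplication by `c ≠ 0` is inverted by the word for `c⁻¹`, so it is linear. -/
theorem exists_smul_eq [CharZero k] (h : W.IsVerbalIso σ) (x : X) (c : k) :
    ∃ a : k, W.smul c = a • of k 0 := by
  rcases eq_or_ne c 0 with rfl | hc
  · refine ⟨0, eval_injective_one x ?_⟩
    have := h.map_smul 0 (of k x)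
    rw [zero_smul, h.apply_zero, h.map_of] at this
    simp [← this]
  · let ψ : FreeAlt k X →ₙₐ[k] Polynomial k := lift k fun _ => Polynomial.X
    have hψ : ψ (of k x) = Polynomial.X := lift_of k _ x
    refine exists_eq_smul_of_comp_eq_X (q := toPoly (W.smul c⁻¹)) ?_
    have := h.map_smul c (c⁻¹ • of k x)
    rw [smul_inv_smul₀ hc, h.map_smul, h.map_of] at this
    have := congrArg ψ this
    rw [map_eval_one, map_eval_one, hψ, eval_eq_toPoly_comp, eval_eq_toPoly_comp,
      Polynomial.comp_X] at this
    exact this.symm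

/-- The words of a system for which there is a verbal isomorphism on two or more generators. The
words for the scalars determine a multiplicative injection `φ` of `k`; homogeneity under the scalar
`φ(2)`, whose powers are distinct, shows that the word for the sum is linear and that for the product
is quadratic. -/
theorem exists_isTwistSystem [CharZero k] (h : W.IsVerbalIso σ) {x y : X} (hxy : x ≠ y) :
    ∃ e φ, ∃ α : k, α ≠ 0 ∧ W.IsTwistSystem e φ α := by
  choose φ hφ using h.exists_smul_eq x
  have hx := of_ne_zero (k := k) x
  have hσ (c : k) (f : FreeAlt k X) : σ (c • f) = φ c • σ f := by
    rw [h.map_smul, hφ, eval_smul, eval_of]; rfl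
  have hcancel {a b : k} (hab : a • of k x = b • of k x) : a = b := smul_left_injective k hx hab
  have hinj : Function.Injective φ := fun a b hab => by
    refine hcancel (σ.injective ?_)
    rw [hσ, hσ, hab]
  have hone : φ 1 = 1 := hcancel <| by
    have := hσ 1 (of k x)
    rw [one_smul, h.map_of] at this
    rw [one_smul, ← this]
  have hmul (a b : k) : φ (a * b) = φ a * φ b := hcancel <| by
    have := hσ (a * b) (of k x)
    rw [mul_smul, hσ, hσ, h.map_of] at this
    rw [← this, mul_smul]
  have hpow (n : ℕ) : φ 2 ^ n = φ (2 ^ n) := by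
    induction n with
    | zero => simp [hone]
    | succ n ih => rw [pow_succ, pow_succ, hmul, ih]
  have htor : Function.Injective fun n : ℕ => φ 2 ^ n := fun m n hmn => by
    have h2 : (2 : k) ^ m = 2 ^ n := hinj (by simpa only [hpow] using hmn)
    exact Nat.pow_right_injective le_rfl (by exact_mod_cast h2)
  -- Compatibility of the sum with the scalar `2` shows that its word has degree one.
  have hadd1 : W.add ∈ homogeneous k (Fin 2) 1 := by
    refine mem_homogeneous_of_scale htor (eval_injective_two hxy ?_)
    simp only [eval_scale_two, eval_smul, pow_one]
    have := hσ 2 (of k x + of k y)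
    rw [smul_add, h.map_add, h.map_add, hσ, hσ, h.map_of, h.map_of] at this
    exact this
  obtain ⟨a, ha⟩ := (Submodule.mem_span_range_iff_exists_fun k).mp (homogeneous_one_le hadd1)
  rw [Fin.sum_univ_two] at ha
  have hadd0 (f g : FreeAlt k X) : σ (f + g) = a 0 • σ f + a 1 • σ g := by
    rw [h.map_add, ← ha]
    simp
  have ha0 : a 0 = 1 := hcancel <| by
    have := hadd0 (of k x) 0
    rw [add_zero, h.apply_zero, smul_zero, add_zero, h.map_of] at this
    rw [one_smul, ← this]
  have ha1 : a 1 = 1 := hcancel <| by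
    have := hadd0 0 (of k x)
    rw [zero_add, h.apply_zero, smul_zero, zero_add, h.map_of] at this
    rw [one_smul, ← this]
  rw [ha0, ha1, one_smul, one_smul] at ha
  have hadd (f g : FreeAlt k X) : σ (f + g) = σ f + σ g := by
    rw [hadd0, ha0, ha1, one_smul, one_smul]
  have hφadd (a b : k) : φ (a + b) = φ a + φ b := hcancel <| by
    have := hσ (a + b) (of k x)
    rw [add_smul, hadd, hσ, hσ, h.map_of] at this
    rw [← this, add_smul]
  have hzero : φ 0 = 0 := by simpa using hφadd 0 0
  -- Likewise `φ(4) = φ(2)²` shows that the word for the product has degree two.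
  have hmul2 : W.mul ∈ homogeneous k (Fin 2) 2 := by
    refine mem_homogeneous_of_scale htor (eval_injective_two hxy ?_)
    simp only [eval_scale_two, eval_smul, hpow]
    have := hσ (2 ^ 2) (of k x * of k y)
    rw [sq, ← smul_mul_smul_comm, h.map_mul, h.map_mul, hσ, hσ, h.map_of, h.map_of, ← sq] at this
    exact this
  obtain ⟨b, hb⟩ := (Submodule.mem_span_range_iff_exists_fun k).mp (homogeneous_two_le hmul2)
  rw [Fintype.sum_prod_type] at hb
  simp only [Fin.sum_univ_two] at hb
  have hmul0 (f g : FreeAlt k X) : σ (f * g) = b (0, 0) • (σ f * σ f) + b (0, 1) • (σ f * σ g) +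
      (b (1, 0) • (σ g * σ f) + b (1, 1) • (σ g * σ g)) := by
    rw [h.map_mul, ← hb]
    simp
  have hb00 : b (0, 0) = 0 := by
    have := hmul0 (of k x) 0
    simp only [mul_zero, zero_mul, h.apply_zero, smul_zero, add_zero, h.map_of] at this
    exact (smul_eq_zero.mp this.symm).resolve_right (of_mul_of_ne_zero x)
  have hb11 : b (1, 1) = 0 := by
    have := hmul0 0 (of k x)
    simp only [mul_zero, zero_mul, h.apply_zero, smul_zero, zero_add, h.map_of] at this
    exact (smul_eq_zero.mp this.symm).resolve_right (of_mul_of_ne_zero x)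
  set α := b (0, 1)
  set β := b (1, 0)
  rw [hb00, hb11, zero_smul, zero_smul, zero_add, add_zero] at hb
  have hσmul (f g : FreeAlt k X) : σ (f * g) = α • (σ f * σ g) + β • (σ g * σ f) := by
    rw [hmul0, hb00, hb11, zero_smul, zero_smul, zero_add, add_zero]
  have hαβ : α * β = 0 := by
    refine mul_eq_zero_of_left_alt hxy (fun f g => α • (f * g) + β • (g * f)) (fun _ _ => rfl) ?_
    have := congrArg σ (IsAlternative.left_alt (of k x) (of k y))
    simpa only [hσmul, h.map_of] using this
  have hne : ¬(α = 0 ∧ β = 0) := by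
    rintro ⟨h1, h2⟩
    have := hσmul (of k x) (of k x)
    rw [h1, h2, zero_smul, add_zero, ← h.apply_zero] at this
    exact of_mul_of_ne_zero x (σ.injective this)
  -- Modulo products, `σ` sends `c x` to `φ(c) x`.
  have hsurj : Function.Surjective φ := by
    let ψ : FreeAlt k X →ₙₐ[k] DualNumber k := lift k fun _ => DualNumber.eps
    have hψ (z : X) : ψ (of k z) = DualNumber.eps := lift_of k _ z
    have hlin (f : FreeAlt k X) : ∃ c, ψ (σ f) = φ c • DualNumber.eps := by
      induction f using FreeAlt.induction with
      | zero => exact ⟨0, by rw [h.apply_zero, _root_.map_zero, hzero, zero_smul]⟩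
      | of z => exact ⟨1, by rw [h.map_of, hψ, hone, one_smul]⟩
      | add f g hf hg =>
        obtain ⟨c, hc⟩ := hf
        obtain ⟨d, hd⟩ := hg
        exact ⟨c + d, by rw [hadd, _root_.map_add, hc, hd, hφadd, add_smul]⟩
      | smul t f hf =>
        obtain ⟨c, hc⟩ := hf
        exact ⟨t * c, by rw [hσ, _root_.map_smul, hc, hmul, mul_smul]⟩
      | mul f g hf hg =>
        obtain ⟨c, hc⟩ := hf
        obtain ⟨d, hd⟩ := hg
        refine ⟨0, ?_⟩
        rw [hσmul, _root_.map_add, _root_.map_smul, _root_.map_smul, _root_.map_mul,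
          _root_.map_mul, hc, hd, hzero]
        simp
    intro t
    obtain ⟨c, hc⟩ := hlin (σ.symm (t • of k x))
    refine ⟨c, ?_⟩
    rw [σ.apply_symm_apply, _root_.map_smul, hψ] at hc
    simpa using (congrArg TrivSqZeroExt.snd hc).symm
  let Φ : RingAut k := RingEquiv.ofBijective
    ({ toFun := φ, map_one' := hone, map_mul' := hmul, map_add' := hφadd,
       map_zero' := hzero } : k →+* k) ⟨hinj, hsurj⟩
  rcases mul_eq_zero.mp hαβ with h0 | h0
  · exact ⟨Equiv.swap 0 1, Φ, β, fun h1 => hne ⟨h0, h1⟩, hφ, ha.symm, by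
      rw [← hb, h0, zero_smul, zero_add, twistMul_swap]⟩
  · exact ⟨1, Φ, α, fun h1 => hne ⟨h1, h0⟩, hφ, ha.symm, by
      rw [← hb, h0, zero_smul, add_zero, twistMul_one]⟩

/-- If the words of `W` are twisted operations with coefficient `α` in the product, then a verbal
isomorphism becomes a twisted isomorphism after multiplication by `α`. -/
theorem isTwisted (h : W.IsVerbalIso σ) {e : Equiv.Perm (Fin 2)} {φ : RingAut k} {α : k}
    (hW : W.IsTwistSystem e φ α) : IsTwisted e φ fun f => α • σ f where
  map_add f g := by rw [h.map_add, hW.add_eq]; simp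
  map_smul c f := by rw [h.map_smul, hW.smul_eq]; simp [smul_comm α]
  map_mul f g := by
    rw [h.map_mul, hW.mul_eq, twistMul_smul_smul, mul_smul, eval_smul]
    congr 2
    rcases perm_fin_two e with rfl | rfl <;> simp

end IsVerbalIso

/-- A twisted system of words has a verbal isomorphism: `α⁻¹ • τ (φ⁻¹(α) x)`, where `τ` is the twisted
automorphism that fixes the generators. -/
theorem IsTwistSystem.exists_isVerbalIso {W : WordSystem k} {e : Equiv.Perm (Fin 2)}
    {φ : RingAut k} {α : k} (hα : α ≠ 0) (hW : W.IsTwistSystem e φ α) (X : Type v) :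
    ∃ σ : FreeAlt k X ≃ FreeAlt k X, W.IsVerbalIso σ := by
  set β := φ.symm α with hβdef
  have hφβ : φ β = α := φ.apply_symm_apply α
  have hβ : β ≠ 0 := by rintro h; rw [h, map_zero] at hφβ; exact hα hφβ.symm
  have hscale {c d : k} (hcd : d * c = 1) (f : FreeAlt k X) : scale d (scale c f) = f :=
    DFunLike.congr_fun (hom_ext (f := (scale d).comp (scale c)) (g := NonUnitalAlgHom.id k _)
      fun x => by simp [scale_of, smul_smul, mul_comm c d, hcd]) f
  have ht := isTwisted_twist (X := X) e φ
  let δ : FreeAlt k X ≃ FreeAlt k X := ⟨scale β, scale β⁻¹, hscale (inv_mul_cancel₀ hβ),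
    hscale (mul_inv_cancel₀ hβ)⟩
  let m : FreeAlt k X ≃ FreeAlt k X := ⟨fun f => α⁻¹ • f, fun f => α • f,
    fun f => smul_inv_smul₀ hα f, fun f => inv_smul_smul₀ hα f⟩
  have hδ (f : FreeAlt k X) : δ f = scale β f := rfl
  have hm (f : FreeAlt k X) : m f = α⁻¹ • f := rfl
  refine ⟨δ.trans ((twist e φ).trans m), ?_, ?_, ?_, ?_, ?_⟩
  · intro x
    simp only [Equiv.trans_apply, hδ, hm, scale_of, ht.map_smul, twist_of, hφβ, inv_smul_smul₀ hα]
  · rw [Subsingleton.elim W.zero 0]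
    simp [hδ, hm, ht.map_zero]
  · intro c f
    rw [hW.smul_eq]
    simp [hδ, hm, ht.map_smul, smul_comm α⁻¹]
  · intro f g
    rw [hW.add_eq]
    simp [hδ, hm, ht.map_add]
  · intro f g
    have hev (a b : FreeAlt k X) : eval k (twistMul e (of k 0) (of k 1)) ![a, b] =
        twistMul e a b := by
      rcases perm_fin_two e with rfl | rfl <;> simp
    rw [hW.mul_eq, eval_smul, hev]
    simp only [Equiv.trans_apply, hδ, hm, map_mul, ht.map_mul, twistMul_smul_smul, smul_smul]
    congr 1
    field_simp

theorem isAdmissible_iff_exists_isVerbalIso (W : WordSystem k) :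
    W.IsAdmissible ↔ ∀ X : FreeAltCat k, ∃ σ : X.alg ≃ X.alg, W.IsVerbalIso σ :=
  forall_congr' fun _ => exists_congr fun _ =>
    ⟨fun h => ⟨h.1, h.2.1, h.2.2.1, h.2.2.2.1, h.2.2.2.2⟩,
      fun h => ⟨h.map_of, h.map_zero, h.map_smul, h.map_add, h.map_mul⟩⟩

/-- The admissible systems of words are the twisted ones. -/
theorem isAdmissible_iff [CharZero k] (W : WordSystem k) :
    W.IsAdmissible ↔ ∃ e φ, ∃ α : k, α ≠ 0 ∧ W.IsTwistSystem e φ α := by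
  rw [isAdmissible_iff_exists_isVerbalIso]
  constructor
  · intro h
    obtain ⟨σ, hσ⟩ := h ⟨{0, 1}⟩
    exact hσ.exists_isTwistSystem (x := ⟨0, by simp⟩) (y := ⟨1, by simp⟩) (by simp)
  · rintro ⟨e, φ, α, hα, hW⟩ X
    exact hW.exists_isVerbalIso hα _

end WordSystem

/-! ### Morphisms of free algebras -/

namespace FreeAltCat

open FreeAlt

variable {k : Type u} [Field k] {X Y Z : FreeAltCat k}

/-- A morphism of `Θ⁰`, as a homomorphism of algebras. -/
def toHom (μ : X ⟶ Y) : X.alg →ₙₐ[k] Y.alg := μ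

/-- A homomorphism of algebras, as a morphism of `Θ⁰`. -/
def ofHom (μ : X.alg →ₙₐ[k] Y.alg) : X ⟶ Y := μ

@[simp]
theorem toHom_ofHom (μ : X.alg →ₙₐ[k] Y.alg) : toHom (ofHom μ) = μ := rfl

@[simp]
theorem toHom_comp (μ : X ⟶ Y) (ν : Y ⟶ Z) (f : X.alg) :
    toHom (μ ≫ ν) f = toHom ν (toHom μ f) := rfl

@[simp]
theorem toHom_id (f : X.alg) : toHom (𝟙 X) f = f := rfl

theorem morphism_ext {μ ν : X ⟶ Y} (h : ∀ x, toHom μ (of k x) = toHom ν (of k x)) : μ = ν :=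
  FreeAlt.hom_ext h

/-- Morphisms from an algebra on one free generator are elements of the target. -/
def homEquiv (L Y : FreeAltCat k) [Unique L.gens] : (L ⟶ Y) ≃ Y.alg where
  toFun μ := toHom μ (of k default)
  invFun f := ofHom (lift k fun _ => f)
  left_inv μ := morphism_ext fun x => by rw [toHom_ofHom, lift_of, Unique.eq_default x]
  right_inv f := lift_of k _ _

theorem homEquiv_comp (L : FreeAltCat k) [Unique L.gens] (μ : L ⟶ X) (ν : X ⟶ Y) :
    homEquiv L Y (μ ≫ ν) = toHom ν (homEquiv L X μ) := rfl

variable (k) in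
/-- The algebra on the free generator `0`. -/
def line : FreeAltCat k := ⟨{0}⟩

instance : Unique (line k).gens where
  default := ⟨0, Finset.mem_singleton_self 0⟩
  uniq x := Subtype.ext (Finset.mem_singleton.mp x.2)

/-! ### Automorphisms preserve the rank one -/

section RankOne

variable (G : FreeAltCat k ⥤ FreeAltCat k) [G.Full]

/-- The image of a free algebra `F(Y)` under an automorphism `G` of the category is a coproduct of
copies of the image of the algebra on one generator: families of elements indexed by the generators
of these copies extend to homomorphisms. -/
theorem exists_map_generators (hG : Function.Surjective G.obj) (Y Z : FreeAltCat k)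
    (g : Y.gens → (G.obj (line k)).gens → Z.alg) :
    ∃ h : G.obj Y ⟶ Z, ∀ y m,
      toHom h (toHom (G.map ((homEquiv (line k) Y).symm (of k y))) (of k m)) = g y m := by
  obtain ⟨Z, rfl⟩ := hG Z
  let ν : Y ⟶ Z := ofHom <| lift k fun y =>
    homEquiv (line k) Z (G.preimage (ofHom (lift k (g y))))
  refine ⟨G.map ν, fun y m => ?_⟩
  have hν : (homEquiv (line k) Y).symm (of k y) ≫ ν = G.preimage (ofHom (lift k (g y))) := by
    apply (homEquiv (line k) Z).injective
    rw [homEquiv_comp, Equiv.apply_symm_apply]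
    exact lift_of k _ y
  rw [← toHom_comp, ← G.map_comp, hν, G.map_preimage]
  exact lift_of k _ m

variable [CharZero k] [G.Faithful]

/-- Two words in one letter cannot be given arbitrary pairs of values: if `v` can take the value `x`
it is linear, so that it vanishes only at `0`, where `u` vanishes as well. -/
theorem false_of_independent_words {L : FreeAltCat k} [Unique L.gens] {u v : L.alg}
    {h h' : L ⟶ L} (hu : toHom h u = of k default) (hv : toHom h v = 0)
    (hv' : toHom h' v = of k default) : False := by
  let ρ : L.alg →ₙₐ[k] FreeAlt k (Fin 1) := lift k fun _ => of k 0
  let π : L.alg →ₙₐ[k] Polynomial k := lift k fun _ => Polynomial.X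
  have key (h : L ⟶ L) (f : L.alg) :
      π (toHom h f) = (toPoly (ρ f)).comp (π (toHom h (of k default))) := by
    rw [← eval_eq_toPoly_comp]
    refine DFunLike.congr_fun (f := π.comp (toHom h)) (g := (lift k (A := Polynomial k)
      ![π (toHom h (of k default))]).comp ρ) (hom_ext fun x => ?_) f
    rw [Unique.eq_default x]
    simp [ρ, lift_of]
  have hπ : π (of k default) = Polynomial.X := lift_of k _ _
  have h1 := key h u
  have h2 := key h v
  have h3 := key h' v
  rw [hu, hπ] at h1
  rw [hv, map_zero] at h2
  rw [hv', hπ] at h3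
  obtain ⟨a, ha⟩ := exists_eq_smul_of_comp_eq_X h3.symm
  rw [ha, map_smul, toPoly_of, Polynomial.smul_comp, Polynomial.X_comp] at h2 h3
  have ha0 : a ≠ 0 := by
    rintro rfl
    rw [zero_smul] at h3
    exact Polynomial.X_ne_zero h3
  rw [(smul_eq_zero.mp h2.symm).resolve_left ha0, Polynomial.comp_zero,
    ← Polynomial.coeff_zero_eq_eval_zero, toPoly_coeff_zero, map_zero] at h1
  exact Polynomial.X_ne_zero h1

theorem exists_unique_generator (hG : Function.Surjective G.obj) :
    Nonempty (Unique (G.obj (line k)).gens) := by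
  obtain ⟨Y, hY⟩ := hG (line k)
  have : Unique (G.obj Y).gens := hY ▸ (inferInstance : Unique (line k).gens)
  -- The algebra on one generator has the identity and the zero endomorphism.
  have hend {L : FreeAltCat k} [Unique L.gens] (h : Subsingleton (L ⟶ L)) : False := by
    have := (homEquiv L L).symm.injective
      (Subsingleton.elim ((homEquiv L L).symm (of k default)) ((homEquiv L L).symm 0))
    exact of_ne_zero _ this
  have hM : Nonempty (G.obj (line k)).gens := by
    by_contra h
    rw [not_nonempty_iff] at h
    exact hend (L := line k) ⟨fun μ ν => G.map_injective (morphism_ext isEmptyElim)⟩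
  have hY' : Nonempty Y.gens := by
    by_contra h
    rw [not_nonempty_iff] at h
    refine hend (L := G.obj Y) ⟨fun μ ν => ?_⟩
    rw [← G.map_preimage μ, ← G.map_preimage ν]
    exact congrArg G.map (morphism_ext isEmptyElim)
  obtain ⟨y⟩ := hY'
  have hsub : Subsingleton (G.obj (line k)).gens := by
    classical
    refine ⟨fun m m' => ?_⟩
    by_contra hne
    obtain ⟨h, hh⟩ := exists_map_generators G hG Y (G.obj Y)
      fun _ n => if n = m then of k default else 0
    obtain ⟨h', hh'⟩ := exists_map_generators G hG Y (G.obj Y)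
      fun _ n => if n = m' then of k default else 0
    refine false_of_independent_words ((hh y m).trans (if_pos rfl))
      ((hh y m').trans (if_neg (Ne.symm hne))) ((hh' y m').trans (if_pos rfl))
  exact ⟨⟨⟨hM.some⟩, fun x => Subsingleton.elim _ _⟩⟩

end RankOne

/-! ### Automorphisms are twisted conjugations -/

/-- The functor `G` is conjugation by twisted isomorphisms `s : F(X) → G(F(X))`. -/
def IsTwistedConj (G : FreeAltCat k ⥤ FreeAltCat k) (e : Equiv.Perm (Fin 2)) (φ : RingAut k) :
    Prop :=
  ∃ s : ∀ X : FreeAltCat k, X.alg ≃ (G.obj X).alg, (∀ X, IsTwisted e φ (s X)) ∧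
    ∀ (X Y : FreeAltCat k) (μ : X ⟶ Y) (f : X.alg),
      toHom (G.map μ) (s X f) = s Y (toHom μ f)

section Conjugation

variable (G : FreeAltCat k ⥤ FreeAltCat k) [G.Full] [G.Faithful] [Unique (G.obj (line k)).gens]

/-- The bijection `F(X) → G(F(X))` obtained by viewing elements as morphisms from the algebra on one
generator. -/
def mainBijection (X : FreeAltCat k) : X.alg ≃ (G.obj X).alg :=
  (homEquiv (line k) X).symm.trans <| (Functor.FullyFaithful.ofFullyFaithful G).homEquiv.trans <|
    homEquiv (G.obj (line k)) (G.obj X)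

theorem map_mainBijection (μ : X ⟶ Y) (f : X.alg) :
    toHom (G.map μ) (mainBijection G X f) = mainBijection G Y (toHom μ f) := by
  have h : (homEquiv (line k) X).symm f ≫ μ = (homEquiv (line k) Y).symm (toHom μ f) := by
    apply (homEquiv (line k) Y).injective
    rw [homEquiv_comp, Equiv.apply_symm_apply, Equiv.apply_symm_apply]
  change toHom (G.map μ) (homEquiv _ _ (G.map _)) = homEquiv _ _ (G.map _)
  rw [← h, G.map_comp, homEquiv_comp]

/-- The images of the free generators of `F(X)` are free generators of `G(F(X))`. -/
theorem existsUnique_map_mainBijection (hG : Function.Surjective G.obj) (X Z : FreeAltCat k)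
    (g : X.gens → Z.alg) :
    ∃! h : G.obj X ⟶ Z, ∀ x, toHom h (mainBijection G X (of k x)) = g x := by
  obtain ⟨Z, rfl⟩ := hG Z
  refine ⟨G.map (ofHom (lift k fun x => (mainBijection G Z).symm (g x))), fun x => ?_,
    fun h hh => ?_⟩
  · rw [map_mainBijection, toHom_ofHom, lift_of, Equiv.apply_symm_apply]
  · obtain ⟨μ, rfl⟩ := G.map_surjective h
    congr 1
    refine morphism_ext fun x => ?_
    rw [toHom_ofHom, lift_of, ← hh x, map_mainBijection, Equiv.symm_apply_apply]

theorem exists_iso_generators (hG : Function.Surjective G.obj) (X : FreeAltCat k) :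
    ∃ (ν : X ⟶ G.obj X) (ν' : G.obj X ⟶ X), (∀ f, toHom ν' (toHom ν f) = f) ∧
      (∀ f, toHom ν (toHom ν' f) = f) ∧ ∀ x, toHom ν (of k x) = mainBijection G X (of k x) := by
  let ν : X ⟶ G.obj X := ofHom (lift k fun x => mainBijection G X (of k x))
  have hν (x) : toHom ν (of k x) = mainBijection G X (of k x) := lift_of k _ x
  obtain ⟨ν', hν', -⟩ := existsUnique_map_mainBijection G hG X X (of k)
  have h1 : ν ≫ ν' = 𝟙 X := morphism_ext fun x => by rw [toHom_comp, hν, hν', toHom_id]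
  have h2 : ν' ≫ ν = 𝟙 (G.obj X) :=
    (existsUnique_map_mainBijection G hG X (G.obj X) _).unique
      (fun x => by rw [toHom_comp, hν', hν]) (fun x => toHom_id _)
  refine ⟨ν, ν', fun f => ?_, fun f => ?_, hν⟩
  · rw [← toHom_comp, h1, toHom_id]
  · rw [← toHom_comp, h2, toHom_id]

/-- If bijections `σ` of the free algebras are compatible with substitution, then `σ` transports each
verbal operation to a verbal operation. -/
theorem exists_word (σ : ∀ X : FreeAltCat k, X.alg ≃ X.alg)
    (hσ : ∀ (X Y : FreeAltCat k) (g : X.gens → Y.alg) (f : X.alg),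
      σ Y (lift k g f) = lift k (fun x => σ Y (g x)) (σ X f)) {m : ℕ} (w : FreeAlt k (Fin m)) :
    ∃ w' : FreeAlt k (Fin m), ∀ (Y : FreeAltCat k) (g : Fin m → Y.alg),
      σ Y (eval k w g) = eval k w' fun i => σ Y (g i) := by
  let P : FreeAltCat k := ⟨Finset.range m⟩
  let idx (i : P.gens) : Fin m := ⟨i, Finset.mem_range.mp i.2⟩
  let gen (i : Fin m) : P.gens := ⟨i, Finset.mem_range.mpr i.2⟩
  refine ⟨lift k (fun i => of k (idx i)) (σ P (lift k (fun i => of k (gen i)) w)),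
    fun Y g => ?_⟩
  have h := hσ P Y (fun i => g (idx i)) (lift k (fun i => of k (gen i)) w)
  rw [map_lift] at h
  rw [FreeAlt.eval, FreeAlt.eval, map_lift]
  simpa only [lift_of] using h

/-- Every automorphism of the category is a twisted conjugation. After a change of free generators
the main bijections are compatible with substitution and fix the generators. They transport the
operations to verbal ones, so that the classification of systems of words applies to them. -/
theorem exists_isTwistedConj_of_unique [CharZero k] (hG : Function.Surjective G.obj) :
    ∃ e φ, IsTwistedConj G e φ := by
  choose ν ν' hν hν' hνs using exists_iso_generators G hG
  let σ (X : FreeAltCat k) : X.alg ≃ X.alg :=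
    (mainBijection G X).trans ⟨toHom (ν' X), toHom (ν X), hν' X, hν X⟩
  have hσ' (X : FreeAltCat k) (f : X.alg) : toHom (ν X) (σ X f) = mainBijection G X f :=
    hν' X _
  have hof (X : FreeAltCat k) (x : X.gens) : σ X (of k x) = of k x := by
    change toHom (ν' X) _ = _
    rw [← hνs, hν]
  have hσ (X Y : FreeAltCat k) (g : X.gens → Y.alg) (f : X.alg) :
      σ Y (lift k g f) = lift k (fun x => σ Y (g x)) (σ X f) := by
    have hκ (f : X.alg) : toHom (ν X ≫ G.map (ofHom (lift k g)) ≫ ν' Y) (σ X f) =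
        σ Y (lift k g f) := by
      rw [toHom_comp, toHom_comp, hσ', map_mainBijection]
      rfl
    rw [← hκ]
    refine DFunLike.congr_fun (hom_ext fun x => ?_) (σ X f)
    rw [lift_of, ← hof X x, hκ, lift_of]
  choose w hw using fun m (w : FreeAlt k (Fin m)) => exists_word σ hσ w
  let W : WordSystem k :=
    { zero := w 0 0
      smul := fun c => w 1 (c • of k 0)
      add := w 2 (of k 0 + of k 1)
      mul := w 2 (of k 0 * of k 1) }
  have hone (X : FreeAltCat k) (a : X.alg) :
      (fun i => σ X ((![a] : Fin 1 → X.alg) i)) = ![σ X a] := by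
    funext i; rw [Subsingleton.elim i 0]; rfl
  have htwo (X : FreeAltCat k) (a b : X.alg) :
      (fun i => σ X ((![a, b] : Fin 2 → X.alg) i)) = ![σ X a, σ X b] := by
    funext i; fin_cases i <;> rfl
  have hW (X : FreeAltCat k) : W.IsVerbalIso (σ X) :=
    { map_of := hof X
      map_zero := by
        have := hw 0 0 X ![]
        rw [eval_zero] at this
        rw [this]
        congr 1
        exact Subsingleton.elim _ _
      map_smul := fun c f => by
        have := hw 1 (c • of k 0) X ![f]
        rwa [hone, eval_smul, eval_of] at this
      map_add := fun f g => by
        have := hw 2 (of k 0 + of k 1) X ![f, g]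
        rwa [htwo, eval_add, eval_of, eval_of] at this
      map_mul := fun f g => by
        have := hw 2 (of k 0 * of k 1) X ![f, g]
        rwa [htwo, eval_mul, eval_of, eval_of] at this }
  obtain ⟨e, φ, α, hα, hT⟩ := (hW ⟨{0, 1}⟩).exists_isTwistSystem
    (x := ⟨0, by simp⟩) (y := ⟨1, by simp⟩) (by simp)
  refine ⟨e, φ, fun X => (mainBijection G X).trans ⟨fun f => α • f, fun f => α⁻¹ • f,
    fun f => inv_smul_smul₀ hα f, fun f => smul_inv_smul₀ hα f⟩, fun X => ?_, fun X Y μ f => ?_⟩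
  · have h := (IsTwisted.of_hom (toHom (ν X))).comp ((hW X).isTwisted hT)
    rw [one_mul, one_mul] at h
    convert h using 1
    funext f
    simp only [Function.comp, map_smul, hσ']
    rfl
  · change toHom (G.map μ) (α • mainBijection G X f) = α • mainBijection G Y (toHom μ f)
    rw [map_smul, map_mainBijection]

end Conjugation

theorem exists_isTwistedConj [CharZero k] (G : FreeAltCat k ⥤ FreeAltCat k) [G.Full] [G.Faithful]
    (hG : Function.Surjective G.obj) : ∃ e φ, IsTwistedConj G e φ := by
  obtain ⟨_⟩ := exists_unique_generator G hG
  exact exists_isTwistedConj_of_unique G hG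

/-- Twisted bijections that commute with all homomorphisms are not twisted at all: they are
multiplications by a scalar. -/
theorem eq_one_of_natural [CharZero k] {e : Equiv.Perm (Fin 2)} {φ : RingAut k}
    {u : ∀ X : FreeAltCat k, X.alg ≃ X.alg} (hu : ∀ X, IsTwisted e φ (u X))
    (hnat : ∀ (X Y : FreeAltCat k) (μ : X ⟶ Y) (f : X.alg),
      toHom μ (u X f) = u Y (toHom μ f)) : e = 1 ∧ φ = 1 := by
  have htor : Function.Injective fun n : ℕ => (2 : k) ^ n := fun m n h => by
    have h2 : (2 : k) ^ m = 2 ^ n := h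
    exact Nat.pow_right_injective le_rfl (by exact_mod_cast h2)
  let t : (line k).alg := of k default
  have hdeg : u (line k) t ∈ homogeneous k (line k).gens 1 := by
    refine mem_homogeneous_of_scale htor ?_
    have h2 : φ 2 = 2 := map_ofNat φ 2
    have := hnat _ _ (ofHom (scale 2)) t
    rw [toHom_ofHom, scale_of, (hu _).map_smul, h2] at this
    rw [this, pow_one]
  have hspan := homogeneous_one_le hdeg
  rw [Set.range_unique, Submodule.mem_span_singleton] at hspan
  obtain ⟨a, ha⟩ := hspan
  have hall (X : FreeAltCat k) (f : X.alg) : u X f = a • f := by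
    have := hnat _ _ ((homEquiv (line k) X).symm f) t
    have ht : toHom ((homEquiv (line k) X).symm f) t = f := (homEquiv (line k) X).apply_symm_apply f
    rw [← ha, map_smul] at this
    rw [← ht]
    exact this.symm
  have ha0 : a ≠ 0 := by
    rintro rfl
    refine of_ne_zero (k := k) (default : (line k).gens) ((u (line k)).injective ?_)
    rw [hall, hall, zero_smul, zero_smul]
  constructor
  · rcases perm_fin_two e with rfl | rfl
    · rfl
    · let P : FreeAltCat k := ⟨{0, 1}⟩
      let x : P.gens := ⟨0, by simp [P]⟩
      let y : P.gens := ⟨1, by simp [P]⟩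
      have hxy : x ≠ y := by simp [x, y]
      have h := (hu P).map_mul (of k x) (of k y)
      rw [hall, hall, hall, twistMul_swap, smul_mul_smul_comm] at h
      exact absurd (eq_zero_of_smul_mul_eq_smul_mul hxy h).1 ha0
  · refine RingEquiv.ext fun c => ?_
    have h := (hu (line k)).map_smul c t
    rw [hall, hall, smul_smul, smul_smul] at h
    have := smul_left_injective k (of_ne_zero (k := k) (default : (line k).gens)) h
    rw [mul_comm] at this
    exact (mul_right_cancel₀ ha0 this).symm

namespace IsTwistedConj

variable {G H : FreeAltCat k ⥤ FreeAltCat k} {e e' : Equiv.Perm (Fin 2)} {φ φ' : RingAut k}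

theorem unique [CharZero k] (h : IsTwistedConj G e φ) (h' : IsTwistedConj G e' φ') :
    e = e' ∧ φ = φ' := by
  obtain ⟨s, hs, hsn⟩ := h
  obtain ⟨t, ht, htn⟩ := h'
  have := eq_one_of_natural (u := fun X => (s X).trans (t X).symm)
    (fun X => (ht X).symm.comp (hs X)) fun X Y μ f => by
      apply (t Y).injective
      simp only [Equiv.trans_apply, ← htn, Equiv.apply_symm_apply, hsn]
  rw [inv_mul_eq_one, inv_mul_eq_one] at this
  exact ⟨this.1.symm, this.2.symm⟩

theorem comp (hG : IsTwistedConj G e φ) (hH : IsTwistedConj H e' φ') :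
    IsTwistedConj (H ⋙ G) (e * e') (φ * φ') := by
  obtain ⟨s, hs, hsn⟩ := hG
  obtain ⟨t, ht, htn⟩ := hH
  refine ⟨fun X => (t X).trans (s (H.obj X)), fun X => (hs _).comp (ht X), fun X Y μ f => ?_⟩
  exact (hsn _ _ (H.map μ) (t X f)).trans (congrArg _ (htn X Y μ f))

theorem iff_nonempty_iso : IsTwistedConj G 1 1 ↔ Nonempty (𝟭 (FreeAltCat k) ≅ G) := by
  constructor
  · rintro ⟨s, hs, hsn⟩
    have hs' (X : FreeAltCat k) : IsTwisted 1 (1 : RingAut k) (s X).symm := by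
      simpa only [inv_one] using (hs X).symm
    refine ⟨NatIso.ofComponents (fun X =>
      { hom := ofHom (hs X).toHom
        inv := ofHom (hs' X).toHom
        hom_inv_id := morphism_ext fun x => (s X).symm_apply_apply _
        inv_hom_id := morphism_ext fun x => (s X).apply_symm_apply _ }) fun {X Y} μ => ?_⟩
    exact morphism_ext fun x => (hsn X Y μ (of k x)).symm
  · rintro ⟨i⟩
    refine ⟨fun X => ⟨toHom (i.hom.app X), toHom (i.inv.app X), fun f => ?_, fun f => ?_⟩,
      fun X => IsTwisted.of_hom (toHom (i.hom.app X)), fun X Y μ f => ?_⟩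
    · exact congrArg (fun μ => toHom μ f) (i.hom_inv_id_app X)
    · exact congrArg (fun μ => toHom μ f) (i.inv_hom_id_app X)
    · exact (congrArg (fun μ => toHom μ f) (i.hom.naturality μ)).symm

end IsTwistedConj

theorem twist_toHom (e : Equiv.Perm (Fin 2)) (φ : RingAut k) (μ : X ⟶ Y) (f : X.alg) :
    lift k (fun x => twist e φ (toHom μ (of k x))) (twist e φ f) = twist e φ (toHom μ f) := by
  have h1 := (IsTwisted.of_hom (lift k fun x => twist e φ (toHom μ (of k x)))).comp
    (isTwisted_twist (X := X.gens) e φ)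
  have h2 := (isTwisted_twist (X := Y.gens) e φ).comp (IsTwisted.of_hom (toHom μ))
  rw [one_mul, one_mul] at h1
  rw [mul_one, mul_one] at h2
  exact h1.eq_of_eq_on_generators h2 (fun x => by simp [twist_of, lift_of]) f

/-- Conjugation by the twisted automorphisms that fix the free generators. -/
def twistFunctor (e : Equiv.Perm (Fin 2)) (φ : RingAut k) : FreeAltCat k ⥤ FreeAltCat k where
  obj X := X
  map μ := ofHom (lift k fun x => twist e φ (toHom μ (of k x)))
  map_id X := morphism_ext fun x => by simp [lift_of, twist_of]
  map_comp {X Y Z} μ ν := morphism_ext fun x => by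
    simp only [toHom_comp, toHom_ofHom, lift_of, twist_toHom]

theorem isTwistedConj_twistFunctor (e : Equiv.Perm (Fin 2)) (φ : RingAut k) :
    IsTwistedConj (twistFunctor e φ) e φ :=
  ⟨fun _ => twist e φ, fun _ => isTwisted_twist e φ, fun _ _ μ f => twist_toHom e φ μ f⟩

theorem twistFunctor_comp {e e' : Equiv.Perm (Fin 2)} {φ φ' : RingAut k} (he : e' * e = 1)
    (hφ : φ' * φ = 1) : twistFunctor e φ ⋙ twistFunctor e' φ' = 𝟭 (FreeAltCat k) := by
  refine CategoryTheory.Functor.ext (fun X => rfl) fun X Y μ => ?_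
  change (twistFunctor e' φ').map ((twistFunctor e φ).map μ) = 𝟙 X ≫ μ ≫ 𝟙 Y
  rw [Category.comp_id, Category.id_comp]
  refine morphism_ext fun x => ?_
  simp only [twistFunctor, toHom_ofHom, lift_of]
  exact (lift_of k _ x).trans (twistMap_twistMap he hφ _)

/-- Conjugation by twisted automorphisms, as an automorphism of the category. -/
def twistAut (e : Equiv.Perm (Fin 2)) (φ : RingAut k) : CatAut (FreeAltCat k) where
  hom := (twistFunctor e φ).toCatHom
  inv := (twistFunctor e⁻¹ φ⁻¹).toCatHom
  hom_inv_id := Cat.Hom.ext (twistFunctor_comp (inv_mul_cancel e) (inv_mul_cancel φ))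
  inv_hom_id := Cat.Hom.ext (twistFunctor_comp (mul_inv_cancel e) (mul_inv_cancel φ))

theorem exists_isTwistedConj_catAut [CharZero k] (Φ : CatAut (FreeAltCat k)) :
    ∃ p : Equiv.Perm (Fin 2) × RingAut k, IsTwistedConj Φ.hom.toFunctor p.1 p.2 := by
  let G : FreeAltCat k ⥤ FreeAltCat k := Φ.hom.toFunctor
  have : G.IsEquivalence := (Cat.equivOfIso Φ).isEquivalence_functor
  have h : Φ.inv.toFunctor ⋙ Φ.hom.toFunctor = 𝟭 _ := congrArg Cat.Hom.toFunctor Φ.inv_hom_id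
  obtain ⟨e, φ, hφ⟩ := exists_isTwistedConj G
    fun X => ⟨Φ.inv.toFunctor.obj X, Functor.congr_obj h X⟩
  exact ⟨(e, φ), hφ⟩

/-- The order of the product and the field automorphism that an automorphism of the category
induces. -/
def twistHom [CharZero k] :
    CatAut (FreeAltCat k) →* Equiv.Perm (Fin 2) × RingAut k :=
  MonoidHom.mk' (fun Φ => (exists_isTwistedConj_catAut Φ).choose) fun Φ Ψ => by
    have h := (exists_isTwistedConj_catAut Φ).choose_spec.comp
      (exists_isTwistedConj_catAut Ψ).choose_spec
    have h' := (exists_isTwistedConj_catAut (Φ * Ψ)).choose_spec.unique h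
    exact Prod.ext h'.1 h'.2

theorem twistHom_eq_iff [CharZero k] (Φ : CatAut (FreeAltCat k))
    (p : Equiv.Perm (Fin 2) × RingAut k) :
    twistHom Φ = p ↔ IsTwistedConj Φ.hom.toFunctor p.1 p.2 := by
  have h := (exists_isTwistedConj_catAut Φ).choose_spec
  constructor
  · rintro rfl
    exact h
  · intro h'
    exact Prod.ext (h.unique h').1 (h.unique h').2

theorem twistHom_surjective [CharZero k] : Function.Surjective (twistHom (k := k)) := fun p =>
  ⟨twistAut p.1 p.2, (twistHom_eq_iff _ _).mpr (isTwistedConj_twistFunctor p.1 p.2)⟩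

theorem ker_twistHom [CharZero k] : (twistHom (k := k)).ker = innerAut (FreeAltCat k) := by
  ext Φ
  rw [MonoidHom.mem_ker, twistHom_eq_iff]
  exact IsTwistedConj.iff_nonempty_iso

end FreeAltCat

end

theorem theorem2 (k : Type u) [Field k] [CharZero k] :
    Nonempty ((CatAut (FreeAltCat k) ⧸ innerAut (FreeAltCat k)) ≃*
      (Equiv.Perm (Fin 2) × RingAut k)) ∧
    (∀ W : WordSystem k, W.IsAdmissible ↔
      W.zero = 0 ∧
      W.add = FreeAlt.of k 0 + FreeAlt.of k 1 ∧
      (∃ φ : RingAut k, ∀ c : k, W.smul c = φ c • FreeAlt.of k 0) ∧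
      (∃ α : k, α ≠ 0 ∧
        (W.mul = α • (FreeAlt.of k 0 * FreeAlt.of k 1) ∨
          W.mul = α • (FreeAlt.of k 1 * FreeAlt.of k 0)))) := by
  refine ⟨⟨(QuotientGroup.quotientMulEquivOfEq FreeAltCat.ker_twistHom.symm).trans
    (QuotientGroup.quotientKerEquivOfSurjective _ FreeAltCat.twistHom_surjective)⟩, fun W => ?_⟩
  rw [W.isAdmissible_iff]
  constructor
  · rintro ⟨e, φ, α, hα, hW⟩
    refine ⟨Subsingleton.elim _ _, hW.add_eq, ⟨φ, hW.smul_eq⟩, α, hα, ?_⟩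
    rw [hW.mul_eq]
    rcases perm_fin_two e with rfl | rfl
    · exact Or.inl (by rw [twistMul_one])
    · exact Or.inr (by rw [twistMul_swap])
  · rintro ⟨-, hadd, ⟨φ, hφ⟩, α, hα, h | h⟩
    · exact ⟨1, φ, α, hα, hφ, hadd, by rw [h, twistMul_one]⟩
    · exact ⟨Equiv.swap 0 1, φ, α, hα, hφ, hadd, by rw [h, twistMul_swap]⟩
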